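/- **Setting.** Let $G=(V,E)$ be an undirected graph, possibly infinite, with loops and multiple edges allowed. Each edge $e$ has a length $\ell_e>0$ and a weight $a_e>0$, each vertex $v$ has a mass $\mathcal V(v)\in(0,\infty)$, and $\partial\mathcal G\subset V$ is a specified set of vertices (the boundary of the graph). Let $\mathcal G$ be the geometric realization: $V$ together with a closed interval of length $\ell_e$ joining the endpoints of $e$, for each $e\in E$; a subset of $\mathcal G$ is open if its trace on every edge interval is open. The vertex measure $\mathcal V$ on $\mathcal G$ is $\sum_v\mathcal V(v)\delta_v$; the edge measure $\mathcal E$ is $a_e$ times Lebesgue measure on the interior of each edge $e$ and does not charge vertices. Norms of functions are taken with respect to $\mathcal V$, norms of gradients (defined on edge interiors) with respect to $\mathcal E$. Put $$\rho_{\sup}=\sup_{v\in V}\rho(v),\qquad \rho(v)=\mathcal V(v)^{-1}\sum_{e\ni v}\mathcal E(e)/2 .$$ A subset of $\mathcal G$ is of finite type if it lies in a union of finitely many vertices and edges. $C^1_{\rm Dir}(\mathcal G)$ is the set of continuous $\phi:\mathcal G\to\mathbb R$ that are differentiable with uniformly continuous derivative on each edge interior, whose support is of finite type, and that vanish on $\partial\mathcal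 G$. An *admissible* set is an open $\Omega\subset\mathcal G$ of finite type, with finite topological boundary $\partial\Omega$, disjoint from $\partial\mathcal G$. The area $\mathcal A(\partial\Omega)$ is the sum of $a_e$ over all points of $\partial\Omega$ interior to an edge ($e$ being that edge), plus, for every vertex $v\in\partial\Omega$, the sum of $a_e$ over the edges $e$ such that $v$ is in the closure of the intersection of $\Omega$ with the interior of $e$. For $1\le\nu\le\infty$ put $$I_\nu=\inf_{\Omega\ \text{admissible}}\frac{\mathcal A(\partial\Omega)}{\mathcal V(\Omega)^{1/\nu'}},\qquad \widetilde I_\nu=\inf_{\Omega\ \text{admissible}}\frac{\mathcal A(\partial\Omega)}{\min(\mathcal V(\Omega),\mathcal V(\mathcal G\setminus\Omega))^{1/\nu'}},$$ where a quotient counts as $+\infty$ when $\mathcal V(\Omega)=0$, respectively when the minimum is $0$. Here and below $q'$ is the dual exponent of $q$: $1/q+1/q'=1$. The graph is *closed* if it is finite and $\partial\mathcal G=\emptyset$. A function $\phi$ is *split* if $\mathcal V(\{\phi>0\})$ and $\mathcal V(\{\phi<0\})$ are both at most $\mathcal V(\mathcal G)/2$. In $[0,\infty]$ we use $0\cdot\infty=0$,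 $0^0=\infty^0=1$, $0^{-s}=\infty$ and $\infty^{-s}=0$ for $s>0$. **Theorem.** (1) Let $1\le p\le\infty$, $1\le\nu\le\infty$, and let $F:\mathbb R\to\mathbb R$ be differentiable and sign-preserving ($F(x)$ is positive, zero or negative according as $x$ is), with $(F')^{p'}$ convex. Here negative values of $F'$ count as $0$ in forming the power $(F')^{p'}$, i.e. $\max(F',0)^{p'}$ is assumed to be convex, and for $p'=\infty$ the condition means that $\max(F',0)$ is quasiconvex. Then for every $\phi\in C^1_{\rm Dir}(\mathcal G)$ $$I_\nu\,\|F(\phi)\|_{\nu'}\le\rho_{\sup}^{1/p'}\,\|\nabla\phi\|_p\,\|F'(\phi)\|_{p'} .$$ If the graph is closed and $\phi\in C^1_{\rm Dir}(\mathcal G)$ is split, the same inequality holds with $\widetilde I_\nu$ in place of $I_\nu$. (2) Let $\nu>p\ge1$ be real numbers. For every $\phi\in C^1_{\rm Dir}(\mathcal G)$ $$\|\nabla\phi\|_p\ge c_{\nu,p}\,\|\phi\|_{p\nu/(\nu-p)},\qquad c_{\nu,p}=I_\nu\,\rho_{\sup}^{-(p-1)/p}\,\frac{\nu-p}{p(\nu-1)}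 .$$ If the graph is closed and $\phi\in C^1_{\rm Dir}(\mathcal G)$ is split, the same inequality holds with $\widetilde I_\nu$ in place of $I_\nu$ in $c_{\nu,p}$. -/

import Mathlib

open MeasureTheory Set
open scoped ENNReal Topology

noncomputable section

/-- A graph (loops, multiple edges, infinitely many vertices or edges allowed) with edge lengths,
a specified boundary, a vertex measure and an edge measure. Edges are undirected: `src`, `tgt` only
name the two ends so that the edge `e` can be parametrised by `[0, len e]`; nothing below depends on
which end is called `src`. -/
structure CalcGraph (V E : Type*) where
  src : E → V
  tgt : E → V
  len : E → ℝ
  len_pos : ∀ e, 0 < len e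
  /-- the boundary, an arbitrary specified set of vertices -/
  bdry : Set V
  /-- the mass of each vertex -/
  mass : V → ℝ
  mass_pos : ∀ v, 0 < mass v
  /-- the density of the edge measure with respect to arc length on each edge -/
  wt : E → ℝ
  wt_pos : ∀ e, 0 < wt e

namespace CalcGraph

variable {V E : Type*} (G : CalcGraph V E)

/-- The points of the geometric realization: the vertices, and the points of the open edges. -/
inductive Point {V E : Type*} (G : CalcGraph V E) : Type _
  | vertex (v : V) : Point G
  | inner (e : E) (t : ℝ) (h0 : 0 < t) (h1 : t < G.len e) : Point G

/-- The parametrisation of the closed edge `e` by `[0, len e]`, extended constantly to `ℝ`. -/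
def chart (e : E) (t : ℝ) : G.Point :=
  if h0 : 0 < t then
    if h1 : t < G.len e then Point.inner e t h0 h1 else Point.vertex (G.tgt e)
  else Point.vertex (G.src e)

/-- The topology of the geometric realization, glued from the edges: a set is open iff its preimage
under the parametrisation of every edge is open. -/
instance : TopologicalSpace G.Point :=
  ⨆ e : E, TopologicalSpace.coinduced (G.chart e) inferInstance

instance : MeasurableSpace G.Point := borel G.Point

instance : BorelSpace G.Point := ⟨rfl⟩

/-- The closed edge `e`, as a set of points. -/
def edge (e : E) : Set G.Point := G.chart e '' Icc 0 (G.len e)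

/-- The interior of the edge `e`, as a set of points. -/
def edgeInterior (e : E) : Set G.Point := G.chart e '' Ioo 0 (G.len e)

/-- The edge `e` has `v` as an endpoint. -/
def Incident (v : V) (e : E) : Prop := G.src e = v ∨ G.tgt e = v

/-- The vertex measure: mass `mass v` at each vertex `v`. -/
def vertexMeasure : Measure G.Point :=
  Measure.sum fun v : V => ENNReal.ofReal (G.mass v) • Measure.dirac (Point.vertex v)

/-- The edge measure: `wt e` times Lebesgue measure on the interior of each edge `e`. -/
def edgeMeasure : Measure G.Point :=
  Measure.sum fun e : E =>
    ENNReal.ofReal (G.wt e) • (volume.restrict (Ioo 0 (G.len e))).map (G.chart e)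

/-- The half-degree `ρ(v) = 𝒱(v)⁻¹ ∑_{e ∋ v} ℰ(e) / 2`. -/
def halfDegree (v : V) : ℝ≥0∞ :=
  (∑' e : {e : E // G.Incident v e}, G.edgeMeasure (G.edge e) / 2) /
    G.vertexMeasure {Point.vertex v}

/-- The supremum of the half-degrees. -/
def rhoSup : ℝ≥0∞ := ⨆ v : V, G.halfDegree v

/-- A set is of finite type if it lies in a union of finitely many vertices and edges. -/
def FiniteType (s : Set G.Point) : Prop :=
  ∃ (A : Set V) (B : Set E), A.Finite ∧ B.Finite ∧
    s ⊆ (⋃ v ∈ A, {Point.vertex v}) ∪ ⋃ e ∈ B, G.edge e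

/-- `C¹`: continuous functions whose restriction to each edge interior is differentiable with
uniformly continuous derivative. -/
def IsC1 (φ : G.Point → ℝ) : Prop :=
  Continuous φ ∧ ∀ e : E,
    DifferentiableOn ℝ (fun t => φ (G.chart e t)) (Ioo 0 (G.len e)) ∧
    UniformContinuousOn (deriv fun t => φ (G.chart e t)) (Ioo 0 (G.len e))

/-- `C¹_Dir`: the `C¹` functions of finite type which vanish on the boundary. -/
def IsC1Dir (φ : G.Point → ℝ) : Prop :=
  G.IsC1 φ ∧ G.FiniteType (tsupport φ) ∧ ∀ v ∈ G.bdry, φ (Point.vertex v) = 0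

/-- The gradient, in the coordinate of each edge. A vector field is not defined at the vertices;
the value `0` given to it there is immaterial, the vertices being null for the edge measure. -/
def grad (φ : G.Point → ℝ) : G.Point → ℝ
  | Point.vertex _ => 0
  | Point.inner e t _ _ => deriv (fun s => φ (G.chart e s)) t

/-- The area of a point: `wt e` in the interior of `e`. Vertices are treated separately below. -/
def pointArea : G.Point → ℝ≥0∞
  | Point.vertex _ => 0
  | Point.inner e _ _ _ => ENNReal.ofReal (G.wt e)

/-- The area of the boundary of an open set `Ω`: each boundary point in the interior of an edge `e`
contributes `wt e`, and each boundary vertex `v` contributes `wt e` for every edge `e` such that `v`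
belongs to the closure of `Ω ∩ edgeInterior e`. -/
def boundaryArea (Ω : Set G.Point) : ℝ≥0∞ :=
  (∑' x : frontier Ω, G.pointArea x) +
    ∑' v : {v : V // Point.vertex v ∈ frontier Ω},
      ∑' e : {e : E // Point.vertex v.1 ∈ closure (Ω ∩ G.edgeInterior e)},
        ENNReal.ofReal (G.wt e)

/-- Admissible sets: open, of finite type, with finite topological boundary, disjoint from the
boundary of the graph. -/
def Admissible (Ω : Set G.Point) : Prop :=
  IsOpen Ω ∧ G.FiniteType Ω ∧ (frontier Ω).Finite ∧ ∀ v ∈ G.bdry, Point.vertex v ∉ Ω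

/-- `i_ν(Ω) = 𝒜(∂Ω) / 𝒱(Ω)^{1/ν'}`, where `1/ν' = 1 - 1/ν`, and `+∞` if `𝒱(Ω) = 0`. -/
def isoRatio (ν : ℝ≥0∞) (Ω : Set G.Point) : ℝ≥0∞ :=
  open Classical in
  if G.vertexMeasure Ω = 0 then ⊤
  else G.boundaryArea Ω / G.vertexMeasure Ω ^ (1 - ν⁻¹).toReal

/-- The isoperimetric constant `I_ν`. -/
def isoConst (ν : ℝ≥0∞) : ℝ≥0∞ :=
  ⨅ (Ω : Set G.Point) (_ : G.Admissible Ω), G.isoRatio ν Ω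

/-- `ĩ_ν(Ω) = 𝒜(∂Ω) / min(𝒱(Ω), 𝒱(Ωᶜ))^{1/ν'}`, and `+∞` if the minimum is `0`. -/
def closedIsoRatio (ν : ℝ≥0∞) (Ω : Set G.Point) : ℝ≥0∞ :=
  open Classical in
  if min (G.vertexMeasure Ω) (G.vertexMeasure Ωᶜ) = 0 then ⊤
  else G.boundaryArea Ω / min (G.vertexMeasure Ω) (G.vertexMeasure Ωᶜ) ^ (1 - ν⁻¹).toReal

/-- The isoperimetric constant `Ĩ_ν` used for closed graphs. -/
def closedIsoConst (ν : ℝ≥0∞) : ℝ≥0∞ :=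
  ⨅ (Ω : Set G.Point) (_ : G.Admissible Ω), G.closedIsoRatio ν Ω

/-- A closed graph: finite, with empty boundary. -/
def IsClosedGraph : Prop := Finite V ∧ Finite E ∧ G.bdry = ∅

/-- `φ` is split: it is positive on at most half, and negative on at most half, of the space. -/
def IsSplit (φ : G.Point → ℝ) : Prop :=
  G.vertexMeasure {x | 0 < φ x} ≤ G.vertexMeasure univ / 2 ∧
    G.vertexMeasure {x | φ x < 0} ≤ G.vertexMeasure univ / 2

/-- `c_{ν,p} = I ρ_sup^{-(p-1)/p} (ν - p) / (p (ν - 1))`, for an isoperimetric constant `I`. -/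
def sobolevConst (I : ℝ≥0∞) (ν p : ℝ) : ℝ≥0∞ :=
  I * G.rhoSup ^ (-((p - 1) / p)) * ENNReal.ofReal ((ν - p) / (p * (ν - 1)))

end CalcGraph

/-- `g^q` is convex on `ℝ`, `1 ≤ q ≤ ∞`, for a real function `g`. A negative value of `g` counts as
`0`, so that the power makes sense for every `q`; for nonnegative `g` this changes nothing, and it
is implied by convexity of `|g|^q`, and of the signed power `g^q` (`q` an odd integer), when `g` is
a derivative. For `q = ∞` convexity of `g^q` is read as its limit form
`g (s x + (1 - s) y) ≤ max (g x) (g y)`. -/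
def PowConvex (g : ℝ → ℝ) (q : ℝ≥0∞) : Prop :=
  (q ≠ ⊤ → ConvexOn ℝ univ fun x => (max (g x) 0) ^ q.toReal) ∧
    (q = ⊤ → QuasiconvexOn ℝ univ fun x => max (g x) 0)

end

/-! Only the values at the vertices matter. For `f : V → ℝ` let `totalVariation f` be the sum of
`a_e |f(tgt e) - f(src e)|`. It is bounded below by isoperimetry and above by the gradient.

Lower bound. A finite set `S` of vertices of finite degree, off the boundary, is the trace of an
admissible set cutting each outgoing edge at its midpoint (`exists_admissible`), so `I ·
𝒱(S)^{1/ν'}` is at most the variation of its indicator. A nonnegative function of finite support is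
a sum of multiples of indicators of nested sets. Variation is additive along this layer cake and the
norm is subadditive, whence `I ‖f‖_{ν'} ≤ totalVariation f`; signs are treated separately
(`mul_eLpNorm_le_totalVariation`).

Upper bound. `F` is replaced by the antiderivative `H` of `max(F', 0)`, which dominates it and has
the same sign. Jensen and Hermite-Hadamard bound the difference quotients of `H` by the `p'`-mean of
`max(F', 0)` at the two ends (`exists_majorant`). Hölder on the edges splits off `‖∇φ‖_p`;
regrouping the endpoint means by vertex produces half-degrees, hence the factor `ρ_sup^{1/p'}`
(`IsC1.totalVariation_le`).

The Sobolev inequality is the case `F(x) = x|x|^r`, with `r` chosen so that `F(φ)` and `F'(φ)` both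
have norms which are powers of a single norm of `φ`. -/

noncomputable section

namespace CalcGraph

/-! ### Charts, topology and measurability on the realization. -/

section Topology

variable {V E : Type*} {G : CalcGraph V E}

theorem isOpen_iff_chart {s : Set G.Point} : IsOpen s ↔ ∀ e, IsOpen (G.chart e ⁻¹' s) := by
  simp only [isOpen_iSup_iff, isOpen_coinduced]

theorem isClosed_iff_chart {s : Set G.Point} :
    IsClosed s ↔ ∀ e, IsClosed (G.chart e ⁻¹' s) := by
  simp only [← isOpen_compl_iff, isOpen_iff_chart, preimage_compl]

theorem continuous_chart (e : E) : Continuous (G.chart e) :=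
  continuous_def.2 fun _ hs => isOpen_iff_chart.1 hs e

theorem continuous_iff_chart {X : Type*} [TopologicalSpace X] {f : G.Point → X} :
    Continuous f ↔ ∀ e, Continuous fun t => f (G.chart e t) :=
  ⟨fun h e => h.comp (continuous_chart e), fun h => continuous_def.2 fun _ hs =>
    isOpen_iff_chart.2 fun e => hs.preimage (h e)⟩

theorem chart_of_nonpos {e : E} {t : ℝ} (h : t ≤ 0) : G.chart e t = .vertex (G.src e) := by
  simp [chart, h.not_gt]

theorem chart_of_ge {e : E} {t : ℝ} (h : G.len e ≤ t) : G.chart e t = .vertex (G.tgt e) := by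
  simp [chart, (G.len_pos e).trans_le h, h.not_gt]

theorem chart_of_mem {e : E} {t : ℝ} (h0 : 0 < t) (h1 : t < G.len e) :
    G.chart e t = .inner e t h0 h1 := by
  simp [chart, h0, h1]

theorem isClosed_image_vertex (A : Set V) : IsClosed (Point.vertex (G := G) '' A) := by
  rw [isClosed_iff_chart]
  intro e
  have : G.chart e ⁻¹' (Point.vertex '' A) =
      {t | t ≤ 0 ∧ G.src e ∈ A} ∪ {t | G.len e ≤ t ∧ G.tgt e ∈ A} := by
    ext t
    rcases le_or_gt t 0 with h | h
    · have := (h.trans_lt (G.len_pos e)).not_ge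
      simp [chart_of_nonpos h, h, this]
    · rcases le_or_gt (G.len e) t with h' | h'
      · simp [chart_of_ge h', h', h.not_ge]
      · simp [chart_of_mem h h', h'.not_ge, h.not_ge]
  rw [this]
  exact (isClosed_Iic.and isClosed_const).union (isClosed_Ici.and isClosed_const)

/-- Every set of vertices is closed in the realization. This allows norms for the vertex measure to
be computed on the discrete space `V`. -/
theorem measurableEmbedding_vertex [MeasurableSpace V] [DiscreteMeasurableSpace V] :
    MeasurableEmbedding (Point.vertex (G := G)) where
  injective _ _ h := by simpa using h
  measurable := .of_discrete
  measurableSet_image' _ _ := (isClosed_image_vertex _).measurableSet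

/-- A function which vanishes at the vertices and is continuous on each open edge is measurable. -/
theorem measurable_of_continuousOn_edges {f : G.Point → ℝ}
    (h0 : ∀ v, f (.vertex v) = 0)
    (hf : ∀ e, ContinuousOn (fun t => f (G.chart e t)) (Ioo 0 (G.len e))) : Measurable f := by
  refine measurable_of_isOpen fun W hW => ?_
  have hU : IsOpen ((range (Point.vertex (G := G)))ᶜ ∩ f ⁻¹' W) := by
    rw [isOpen_iff_chart]
    intro e
    convert (hf e).isOpen_inter_preimage isOpen_Ioo hW using 1
    ext t
    rcases le_or_gt t 0 with h | h
    · simp [chart_of_nonpos h, h.not_gt]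
    · rcases le_or_gt (G.len e) t with h' | h'
      · simp [chart_of_ge h', h'.not_gt]
      · simp [chart_of_mem h h', h, h']
  have hV : MeasurableSet (range (Point.vertex (G := G)) ∩ f ⁻¹' W) := by
    convert (isClosed_image_vertex (G := G) {_v | (0 : ℝ) ∈ W}).measurableSet using 1
    ext x
    cases x <;> simp [h0]
  convert hU.measurableSet.union hV using 1
  rw [← union_inter_distrib_right, compl_union_self, univ_inter]

end Topology

/-! ### The edge measure, and the vertex measure transported to `V`. -/

section Measure

variable {V E : Type*} (G : CalcGraph V E)

theorem lintegral_edgeMeasure {f : G.Point → ℝ≥0∞} (hf : Measurable f) :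
    ∫⁻ x, f x ∂G.edgeMeasure =
      ∑' e, ENNReal.ofReal (G.wt e) * ∫⁻ t in Ioo 0 (G.len e), f (G.chart e t) := by
  simp only [edgeMeasure, lintegral_sum_measure, lintegral_smul_measure, smul_eq_mul]
  simp_rw [lintegral_map hf (continuous_chart _).measurable]

/-- A lower bound suffices for comparison with the half-degree, and it avoids measurability of the
closed edge. -/
theorem wt_mul_len_le_edgeMeasure (e : E) :
    ENNReal.ofReal (G.wt e) * ENNReal.ofReal (G.len e) ≤ G.edgeMeasure (G.edge e) := by
  refine le_trans ?_ (Measure.le_sum_apply _ _)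
  refine le_trans ?_ (ENNReal.le_tsum e)
  rw [Measure.smul_apply, smul_eq_mul]
  gcongr
  refine le_trans ?_ (Measure.le_map_apply (continuous_chart e).aemeasurable _)
  have h : Ioo 0 (G.len e) ⊆ G.chart e ⁻¹' G.edge e := fun t ht =>
    mem_image_of_mem (G.chart e) (Ioo_subset_Icc_self ht)
  refine le_trans ?_ (measure_mono h)
  simp

/-- The vertex measure as a measure on the set of vertices. -/
def massMeasure [MeasurableSpace V] : Measure V :=
  Measure.sum fun v : V => ENNReal.ofReal (G.mass v) • Measure.dirac v

variable [MeasurableSpace V] [DiscreteMeasurableSpace V]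

theorem vertexMeasure_eq_map : G.vertexMeasure = G.massMeasure.map Point.vertex := by
  ext s hs
  rw [measurableEmbedding_vertex.map_apply, vertexMeasure, massMeasure, Measure.sum_apply _ hs,
    Measure.sum_apply _ .of_discrete]
  simp only [Measure.smul_apply, Measure.dirac_apply' _ hs, Measure.dirac_apply]
  rfl

theorem vertexMeasure_apply (s : Set G.Point) :
    G.vertexMeasure s = G.massMeasure (Point.vertex ⁻¹' s) := by
  rw [vertexMeasure_eq_map, measurableEmbedding_vertex.map_apply]

theorem eLpNorm_vertexMeasure (f : G.Point → ℝ) (q : ℝ≥0∞) :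
    eLpNorm f q G.vertexMeasure = eLpNorm (fun v => f (.vertex v)) q G.massMeasure := by
  rw [vertexMeasure_eq_map, measurableEmbedding_vertex.eLpNorm_map_measure]
  rfl

theorem lintegral_massMeasure (f : V → ℝ≥0∞) :
    ∫⁻ v, f v ∂G.massMeasure = ∑' v, ENNReal.ofReal (G.mass v) * f v := by
  simp [massMeasure, lintegral_sum_measure]

theorem massMeasure_singleton (v : V) : G.massMeasure {v} = ENNReal.ofReal (G.mass v) := by
  rw [← lintegral_indicator_one .of_discrete, lintegral_massMeasure,
    tsum_eq_single v fun w hw => by simp [hw]]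
  simp

/-- All masses are positive, so "almost everywhere" means "everywhere" on `V`. -/
theorem massMeasure_eq_zero {s : Set V} : G.massMeasure s = 0 ↔ s = ∅ := by
  refine ⟨fun h => ?_, fun h => by simp [h]⟩
  by_contra! hs
  obtain ⟨v, hv⟩ := hs
  have := measure_mono_null (singleton_subset_iff.2 hv) h
  simp [massMeasure_singleton, (G.mass_pos v).not_ge] at this

theorem massMeasure_lt_top {s : Set V} (hs : s.Finite) : G.massMeasure s < ⊤ := by
  rw [← biUnion_of_singleton s]
  exact (measure_biUnion_lt_top hs fun v _ => by simp [massMeasure_singleton])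

theorem ae_massMeasure {P : V → Prop} : (∀ᵐ v ∂G.massMeasure, P v) ↔ ∀ v, P v := by
  rw [ae_iff, massMeasure_eq_zero]
  simp [eq_empty_iff_forall_notMem]

theorem vertexMeasure_singleton (v : V) :
    G.vertexMeasure {Point.vertex v} = ENNReal.ofReal (G.mass v) := by
  rw [vertexMeasure_apply, ← massMeasure_singleton]
  congr 1
  ext; simp

end Measure

end CalcGraph

namespace CalcGraph

/-! ### Isoperimetry and total variation of functions on the vertices. -/

section TotalVariation

variable {V E : Type*} (G : CalcGraph V E)

/-- The total variation of the edgewise monotone extension of a function on the vertices. -/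
def totalVariation (f : V → ℝ) : ℝ≥0∞ :=
  ∑' e, ENNReal.ofReal (G.wt e) * ‖f (G.tgt e) - f (G.src e)‖ₑ

/-- The edgewise linear interpolation of a function on the vertices. -/
def interpolate (f : V → ℝ) : G.Point → ℝ
  | .vertex v => f v
  | .inner e t _ _ => f (G.src e) + t / G.len e * (f (G.tgt e) - f (G.src e))

variable {G}

theorem interpolate_chart (f : V → ℝ) (e : E) (t : ℝ) :
    G.interpolate f (G.chart e t) =
      f (G.src e) + max 0 (min t (G.len e)) / G.len e * (f (G.tgt e) - f (G.src e)) := by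
  have hl := G.len_pos e
  rcases le_or_gt t 0 with h | h
  · simp [chart_of_nonpos h, interpolate, h]
  · rcases le_or_gt (G.len e) t with h' | h'
    · simp [chart_of_ge h', interpolate, h', hl.le, hl.ne']
    · simp [chart_of_mem h h', interpolate, h.le, h'.le]

theorem continuous_interpolate (f : V → ℝ) : Continuous (G.interpolate f) := by
  rw [continuous_iff_chart]
  intro e
  simp_rw [interpolate_chart]
  fun_prop

/-- A finite set of vertices, each of finite degree, disjoint from the boundary, bounds an
admissible set which contains exactly these vertices and whose boundary consists of the midpoints
of the edges which leave the set. -/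
theorem exists_admissible {S : Set V} (hS : S.Finite)
    (hE : {e | G.src e ∈ S ∨ G.tgt e ∈ S}.Finite) (hb : ∀ v ∈ G.bdry, v ∉ S) :
    ∃ Ω : Set G.Point, G.Admissible Ω ∧ Point.vertex ⁻¹' Ω = S ∧
      G.boundaryArea Ω ≤ G.totalVariation (S.indicator 1) := by
  classical
  set w := G.interpolate (S.indicator 1) with hw
  have hwc : Continuous w := continuous_interpolate _
  set Ω : Set G.Point := {x | 1 / 2 < w x} with hΩ
  have hΩo : IsOpen Ω := isOpen_lt continuous_const hwc
  have hpre : Point.vertex ⁻¹' Ω = S := by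
    ext v
    by_cases hv : v ∈ S <;> simp [hΩ, hw, interpolate, hv] <;> norm_num
  have hfr : ∀ x ∈ frontier Ω, w x = 1 / 2 := fun x hx =>
    (frontier_lt_subset_eq continuous_const hwc hx).symm
  -- On the frontier `w = 1/2`. This excludes vertices, where `w` is 0 or 1, and edges with both
  -- ends on the same side, where `w` is constant; on a cut edge it forces the midpoint.
  have hmid : ∀ x : frontier Ω, ∃ e, ∃ h0 h1, x.1 = Point.inner e (G.len e / 2) h0 h1 ∧
      ((G.src e ∈ S ∧ G.tgt e ∉ S) ∨ (G.src e ∉ S ∧ G.tgt e ∈ S)) := by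
    rintro ⟨x, hx⟩
    have h := hfr x hx
    cases x with
    | vertex v => by_cases hv : v ∈ S <;> simp [hw, interpolate, hv] at h
    | inner e t h0 h1 =>
      have hl := G.len_pos e
      refine ⟨e, by positivity, by linarith, ?_⟩
      have ht : ∀ s, s = t → ∀ a b, Point.inner e t h0 h1 = (Point.inner e s a b : G.Point) := by
        rintro s rfl a b; rfl
      by_cases hs : G.src e ∈ S <;> by_cases htg : G.tgt e ∈ S <;>
        simp only [hw, interpolate, hs, htg, indicator_of_mem, indicator_of_notMem,
          not_false_eq_true, Pi.one_apply] at h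
      · norm_num at h
      · refine ⟨ht _ ?_ _ _, by simp [hs, htg]⟩
        field_simp at h
        linarith
      · refine ⟨ht _ ?_ _ _, by simp [hs, htg]⟩
        field_simp at h
        linarith
      · norm_num at h
  choose c h0 h1 hc hcut using hmid
  -- One frontier point per cut edge: this gives both the finiteness of the frontier and the area
  -- bound.
  have hinj : Function.Injective c := by
    intro x y hxy
    have hp : ∀ e e' (h : e = e') a b a' b',
        (Point.inner e (G.len e / 2) a b : G.Point) = Point.inner e' (G.len e' / 2) a' b' := by
      rintro e _ rfl a b a' b'; rfl
    refine Subtype.ext ?_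
    rw [hc x, hc y]
    exact hp _ _ hxy _ _ _ _
  refine ⟨Ω, ⟨hΩo, ⟨S, _, hS, hE, ?_⟩, ?_, ?_⟩, hpre, ?_⟩
  · intro x hx
    cases x with
    | vertex v =>
      left
      have : v ∈ S := by rw [← hpre]; exact hx
      simpa using this
    | inner e t h0 h1 =>
      right
      have he : G.src e ∈ S ∨ G.tgt e ∈ S := by
        by_contra! h
        simp [hΩ, hw, interpolate, h.1, h.2] at hx
        norm_num at hx
      exact mem_biUnion (x := e) he ⟨t, ⟨h0.le, h1.le⟩, chart_of_mem h0 h1⟩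
  · have hc' : ∀ x, c x ∈ {e | G.src e ∈ S ∨ G.tgt e ∈ S} := fun x =>
      (hcut x).elim (fun h => .inl h.1) fun h => .inr h.2
    have := hE.to_subtype
    exact Finite.of_injective (fun x : frontier Ω => (⟨c x, hc' x⟩ : {e | _}))
      fun x y h => hinj (congrArg Subtype.val h)
  · intro v hv hvΩ
    exact hb v hv (hpre ▸ hvΩ)
  · have hempty : IsEmpty {v : V // Point.vertex v ∈ frontier Ω} :=
      ⟨fun v => by simpa using hc ⟨_, v.2⟩⟩
    refine (add_le_of_nonpos_right tsum_empty.le).trans ?_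
    rw [totalVariation]
    calc ∑' x : frontier Ω, G.pointArea x
        ≤ ∑' x : frontier Ω, ENNReal.ofReal (G.wt (c x)) *
          ‖S.indicator (1 : V → ℝ) (G.tgt (c x)) - S.indicator 1 (G.src (c x))‖ₑ := by
          refine ENNReal.tsum_le_tsum fun x => ?_
          have h1 : G.pointArea x = ENNReal.ofReal (G.wt (c x)) := by
            conv_lhs => rw [hc x]
            rfl
          rw [h1]
          rcases hcut x with h | h <;> simp [h.1, h.2]
      _ ≤ _ := ENNReal.tsum_comp_le_tsum_of_injective hinj (fun e =>
          ENNReal.ofReal (G.wt e) *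
            ‖S.indicator (1 : V → ℝ) (G.tgt e) - S.indicator 1 (G.src e)‖ₑ)

theorem toReal_one_sub_inv {ν ν' : ℝ≥0∞} (h : ν.HolderConjugate ν') :
    (1 - ν⁻¹).toReal = 1 / ν'.toReal := by
  have h1 : ν⁻¹ + ν'⁻¹ = 1 := by simpa using! h.inv_add_inv_eq_inv
  have h2 : ν⁻¹ ≠ ⊤ := ne_top_of_le_ne_top ENNReal.one_ne_top (h1 ▸ le_self_add)
  rw [← h1, ENNReal.add_sub_cancel_left h2, ENNReal.toReal_inv, one_div]

variable [MeasurableSpace V] [DiscreteMeasurableSpace V]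

theorem isoConst_mul_le {ν ν' : ℝ≥0∞} (hν : ν.HolderConjugate ν') {S : Set V} (hS : S.Finite)
    (hne : S.Nonempty) (hE : {e | G.src e ∈ S ∨ G.tgt e ∈ S}.Finite)
    (hb : ∀ v ∈ G.bdry, v ∉ S) :
    G.isoConst ν * G.massMeasure S ^ (1 / ν'.toReal) ≤ G.totalVariation (S.indicator 1) := by
  obtain ⟨Ω, hΩ, hpre, hA⟩ := exists_admissible hS hE hb
  have hm : G.vertexMeasure Ω = G.massMeasure S := by rw [vertexMeasure_apply, hpre]
  have h0 : G.massMeasure S ≠ 0 := fun h => hne.ne_empty (massMeasure_eq_zero G |>.1 h)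
  have h1 : G.massMeasure S ≠ ⊤ := (massMeasure_lt_top G hS).ne
  have h : G.isoConst ν ≤ G.isoRatio ν Ω := iInf₂_le Ω hΩ
  rw [isoRatio, hm, if_neg h0, toReal_one_sub_inv hν] at h
  exact (ENNReal.mul_le_of_le_div h).trans hA

theorem closedIsoConst_mul_le {ν ν' : ℝ≥0∞} (hν : ν.HolderConjugate ν') {S : Set V}
    (hS : S.Finite) (hne : S.Nonempty) (hE : {e | G.src e ∈ S ∨ G.tgt e ∈ S}.Finite)
    (hb : ∀ v ∈ G.bdry, v ∉ S) (hle : G.massMeasure S ≤ G.massMeasure Sᶜ) :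
    G.closedIsoConst ν * G.massMeasure S ^ (1 / ν'.toReal) ≤
      G.totalVariation (S.indicator 1) := by
  obtain ⟨Ω, hΩ, hpre, hA⟩ := exists_admissible hS hE hb
  have hm : min (G.vertexMeasure Ω) (G.vertexMeasure Ωᶜ) = G.massMeasure S := by
    rw [vertexMeasure_apply, vertexMeasure_apply, preimage_compl, hpre, min_eq_left hle]
  have h0 : G.massMeasure S ≠ 0 := fun h => hne.ne_empty (massMeasure_eq_zero G |>.1 h)
  have h : G.closedIsoConst ν ≤ G.closedIsoRatio ν Ω := iInf₂_le Ω hΩ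
  rw [closedIsoRatio, hm, if_neg h0, toReal_one_sub_inv hν] at h
  exact (ENNReal.mul_le_of_le_div h).trans hA

/-- The layer cake argument: an isoperimetric inequality for the subsets of the support of a
nonnegative function implies a functional inequality. -/
theorem mul_eLpNorm_le_totalVariation_of_nonneg {I q : ℝ≥0∞} (hq : 1 ≤ q) {f : V → ℝ}
    (hf : 0 ≤ f) (hfin : f.support.Finite)
    (hI : ∀ S ⊆ f.support, S.Nonempty →
      I * G.massMeasure S ^ (1 / q.toReal) ≤ G.totalVariation (S.indicator 1)) :
    I * eLpNorm f q G.massMeasure ≤ G.totalVariation f := by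
  classical
  induction hn : f.support.ncard using Nat.strong_induction_on generalizing f with
  | _ n ih =>
  rcases f.support.eq_empty_or_nonempty with hS | hS
  · rw [Function.support_eq_empty_iff.1 hS]
    simp
  obtain ⟨v₀, hv₀, hmin⟩ := exists_min_image _ f hfin hS
  set S := f.support with hSdef
  set c := f v₀ with hc
  have hcpos : 0 < c := lt_of_le_of_ne (hf v₀) (Ne.symm hv₀)
  -- Peel off the lowest layer: `c` is the least nonzero value of `f`, so `g` stays nonnegative and
  -- its support loses at least `v₀`.
  set g : V → ℝ := f - S.indicator (fun _ => c) with hg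
  have hg_mem : ∀ v ∈ S, g v = f v - c := fun v hv => by simp [hg, hv]
  have hg_not : ∀ v ∉ S, g v = 0 := fun v hv => by
    simp [hg, hv, Function.notMem_support.1 hv]
  have hf_not : ∀ v ∉ S, f v = 0 := fun v hv => Function.notMem_support.1 hv
  have hgS : g.support ⊂ S := by
    refine ⟨fun v hv => by_contra fun h => hv (hg_not v h), fun h => h hv₀ ?_⟩
    rw [hg_mem v₀ hv₀, hc, sub_self]
  have hg0 : 0 ≤ g := fun v => by
    by_cases hv : v ∈ S
    · simpa [hg_mem v hv] using hmin v hv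
    · simp [hg_not v hv]
  have key := ih _ (hn ▸ ncard_lt_ncard hgS hfin) hg0 (hfin.subset hgS.1)
    (fun T hT => hI T (hT.trans hgS.1)) rfl
  -- No cancellation occurs: inside `S` the differences of `f` and `g` agree, and on an edge leaving
  -- `S` the difference is `f = c + (f - c)` with both terms nonnegative.
  have htv : G.totalVariation f =
      ‖c‖ₑ * G.totalVariation (S.indicator 1) + G.totalVariation g := by
    simp only [totalVariation]
    rw [← ENNReal.tsum_mul_left, ← ENNReal.tsum_add]
    congr 1 with e
    rw [mul_left_comm, ← mul_add]
    congr 1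
    by_cases hs : G.src e ∈ S <;> by_cases ht : G.tgt e ∈ S <;>
      simp only [hs, ht, hg_mem, hg_not, hf_not, indicator_of_mem, indicator_of_notMem,
          not_false_eq_true, Pi.one_apply, sub_zero, zero_sub, enorm_neg, sub_self, enorm_zero,
          enorm_one, mul_zero, mul_one, zero_add, sub_sub_sub_cancel_right]
    · have h1 := hmin _ hs
      rw [Real.enorm_of_nonneg (hf _), Real.enorm_of_nonneg hcpos.le,
        Real.enorm_of_nonneg (sub_nonneg.2 h1), ← ENNReal.ofReal_add hcpos.le (sub_nonneg.2 h1)]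
      congr 1; ring
    · have h1 := hmin _ ht
      rw [Real.enorm_of_nonneg (hf _), Real.enorm_of_nonneg hcpos.le,
        Real.enorm_of_nonneg (sub_nonneg.2 h1), ← ENNReal.ofReal_add hcpos.le (sub_nonneg.2 h1)]
      congr 1; ring
  have hfg : f = S.indicator (fun _ => c) + g := by simp [hg]
  have hμ : G.massMeasure S ≠ 0 := fun h => hS.ne_empty (massMeasure_eq_zero G |>.1 h)
  calc I * eLpNorm f q G.massMeasure
      ≤ I * (eLpNorm (S.indicator fun _ => c) q G.massMeasure +
          eLpNorm g q G.massMeasure) := by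
        conv_lhs => rw [hfg]
        gcongr
        exact eLpNorm_add_le (Measurable.of_discrete).aestronglyMeasurable
          (Measurable.of_discrete).aestronglyMeasurable hq
    _ = ‖c‖ₑ * (I * G.massMeasure S ^ (1 / q.toReal)) + I * eLpNorm g q G.massMeasure := by
        rw [eLpNorm_indicator_const' .of_discrete hμ (by positivity)]
        ring
    _ ≤ _ := by
        rw [htv]
        gcongr
        exact hI S subset_rfl hS

theorem mul_eLpNorm_le_totalVariation {I q : ℝ≥0∞} (hq : 1 ≤ q) {f : V → ℝ}
    (hfin : f.support.Finite)
    (hI : ∀ S, S ⊆ {v | 0 < f v} ∨ S ⊆ {v | f v < 0} → S.Nonempty →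
      I * G.massMeasure S ^ (1 / q.toReal) ≤ G.totalVariation (S.indicator 1)) :
    I * eLpNorm f q G.massMeasure ≤ G.totalVariation f := by
  have hp : Function.support f⁺ ⊆ {v | 0 < f v} := fun v hv => by
    by_contra h
    exact hv (by simpa [posPart_def] using h)
  have hn : Function.support f⁻ ⊆ {v | f v < 0} := fun v hv => by
    by_contra h
    exact hv (by simpa [negPart_def] using h)
  have h1 := mul_eLpNorm_le_totalVariation_of_nonneg (G := G) hq (f := f⁺) (posPart_nonneg f)
    (hfin.subset (hp.trans fun v hv => ne_of_gt hv)) fun S hS => hI S (.inl (hS.trans hp))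
  have h2 := mul_eLpNorm_le_totalVariation_of_nonneg (G := G) hq (f := f⁻) (negPart_nonneg f)
    (hfin.subset (hn.trans fun v hv => ne_of_lt hv)) fun S hS => hI S (.inr (hS.trans hn))
  have htv : G.totalVariation f = G.totalVariation f⁺ + G.totalVariation f⁻ := by
    simp only [totalVariation]
    rw [← ENNReal.tsum_add]
    congr 1 with e
    rw [← mul_add]
    congr 1
    simp only [Pi.posPart_apply, Pi.negPart_apply]
    generalize f (G.tgt e) = x
    generalize f (G.src e) = y
    rw [Real.enorm_eq_ofReal_abs, Real.enorm_eq_ofReal_abs, Real.enorm_eq_ofReal_abs,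
      ← ENNReal.ofReal_add (abs_nonneg _) (abs_nonneg _)]
    congr 1
    simp only [posPart_def, negPart_def]
    grind
  calc I * eLpNorm f q G.massMeasure
      ≤ I * (eLpNorm f⁺ q G.massMeasure + eLpNorm f⁻ q G.massMeasure) := by
        gcongr
        conv_lhs => rw [← posPart_sub_negPart f]
        exact eLpNorm_sub_le (Measurable.of_discrete).aestronglyMeasurable
          (Measurable.of_discrete).aestronglyMeasurable hq
    _ ≤ _ := by
        rw [htv, mul_add]
        exact add_le_add h1 h2

end TotalVariation

end CalcGraph

/-! ### Convexity estimates on the real line. -/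

section RealFunctions

/-- The fundamental theorem of calculus as an inequality, without integrability hypotheses. -/
theorem enorm_sub_le_lintegral_enorm_deriv {ψ : ℝ → ℝ} {a b : ℝ} (hab : a ≤ b)
    (hc : ContinuousOn ψ (Icc a b)) (hd : DifferentiableOn ℝ ψ (Ioo a b)) :
    ‖ψ b - ψ a‖ₑ ≤ ∫⁻ t in Ioo a b, ‖deriv ψ t‖ₑ := by
  by_cases h : ∫⁻ t in Ioo a b, ‖deriv ψ t‖ₑ = ⊤
  · simp [h]
  have hi : IntegrableOn (deriv ψ) (Ioo a b) :=
    ⟨(measurable_deriv ψ).aestronglyMeasurable, Ne.lt_top h⟩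
  have hint : IntervalIntegrable (deriv ψ) volume a b :=
    (intervalIntegrable_iff_integrableOn_Ioo_of_le hab).2 hi
  rw [← intervalIntegral.integral_eq_sub_of_hasDeriv_right_of_le hab hc
    (fun t ht => ((hd t ht).differentiableAt (Ioo_mem_nhds ht.1 ht.2)).hasDerivAt.hasDerivWithinAt)
    hint, intervalIntegral.integral_of_le hab, integral_Ioc_eq_integral_Ioo]
  exact enorm_integral_le_lintegral_enorm _

/-- The right half of the Hermite-Hadamard inequality. -/
theorem ConvexOn.integral_le_average_endpoints {g : ℝ → ℝ} (hg : ConvexOn ℝ univ g) {a b : ℝ}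
    (hab : a ≤ b) : ∫ x in a..b, g x ≤ (b - a) * ((g a + g b) / 2) := by
  have hc : Continuous g := by
    simpa [continuousOn_univ] using hg.continuousOn isOpen_univ
  -- Symmetrize by the reflection `x ↦ a + b - x`: convexity gives `g x + g (a + b - x) ≤ g a + g
  -- b`.
  have h1 : ∫ x in a..b, g (a + b - x) = ∫ x in a..b, g x := by
    rw [intervalIntegral.integral_comp_sub_left]
    simp
  have h2 : ∫ x in a..b, (g x + g (a + b - x)) ≤ ∫ _x in a..b, (g a + g b) := by
    refine intervalIntegral.integral_mono_on hab (Continuous.intervalIntegrable (by fun_prop) _ _)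
      (Continuous.intervalIntegrable (by fun_prop) _ _) fun x hx => ?_
    obtain ⟨s, t, hs, ht, hst, rfl⟩ := (segment_eq_Icc hab).symm ▸ hx
    have e : a + b - (s • a + t • b) = t • a + s • b := by
      simp only [smul_eq_mul]
      linear_combination (-a - b) * hst
    rw [e]
    have := hg.2 (mem_univ a) (mem_univ b) hs ht hst
    have := hg.2 (mem_univ a) (mem_univ b) ht hs ((add_comm _ _).trans hst)
    simp only [smul_eq_mul] at *
    have : g a + g b = s * g a + t * g b + (t * g a + s * g b) := by
      linear_combination (-g a - g b) * hst
    linarith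
  rw [intervalIntegral.integral_add (hc.intervalIntegrable _ _)
    (Continuous.intervalIntegrable (by fun_prop) _ _), h1, intervalIntegral.integral_const,
    smul_eq_mul] at h2
  linarith

/-- The `q`-mean of two nonnegative numbers, the maximum if `q = ∞`. -/
def powMean (q : ℝ≥0∞) (x y : ℝ) : ℝ :=
  open Classical in
  if q = ⊤ then max x y else ((x ^ q.toReal + y ^ q.toReal) / 2) ^ (1 / q.toReal)

theorem powMean_comm (q : ℝ≥0∞) (x y : ℝ) : powMean q x y = powMean q y x := by
  simp only [powMean, max_comm, add_comm]

theorem powMean_nonneg (q : ℝ≥0∞) {x y : ℝ} (hx : 0 ≤ x) (hy : 0 ≤ y) : 0 ≤ powMean q x y := by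
  unfold powMean
  split_ifs <;> positivity

variable {g : ℝ → ℝ} {q : ℝ≥0∞}

theorem PowConvex.continuous_of_ne_top (hg : PowConvex g q) (hq : 1 ≤ q) (h : q ≠ ⊤) :
    Continuous fun x => max (g x) 0 := by
  have hq0 : 0 < q.toReal := ENNReal.toReal_pos (zero_lt_one.trans_le hq).ne' h
  have hc : Continuous fun x => max (g x) 0 ^ q.toReal := by
    simpa [continuousOn_univ] using (hg.1 h).continuousOn isOpen_univ
  convert hc.rpow_const (p := 1 / q.toReal) fun _ => .inr (by positivity) using 2 with x
  rw [← Real.rpow_mul (le_max_right _ _), mul_one_div_cancel hq0.ne', Real.rpow_one]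

theorem PowConvex.le_max_of_eq_top (hg : PowConvex g q) (h : q = ⊤) {a b x : ℝ}
    (hx : x ∈ Icc a b) : max (g x) 0 ≤ max (max (g a) 0) (max (g b) 0) :=
  ((hg.2 h (max (max (g a) 0) (max (g b) 0))).ordConnected.out ⟨mem_univ _, le_max_left _ _⟩
    ⟨mem_univ _, le_max_right _ _⟩ hx).2

/-- For finite `q` the function is continuous. A quasiconvex function need not be, so for `q = ∞`
boundedness by the endpoint values and measurability are used instead. -/
theorem PowConvex.intervalIntegrable (hg : PowConvex g q) (hq : 1 ≤ q) (hm : Measurable g)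
    (a b : ℝ) : IntervalIntegrable (fun x => max (g x) 0) volume a b := by
  by_cases h : q = ⊤
  · wlog hab : a ≤ b generalizing a b
    · exact (this b a (le_of_not_ge hab)).symm
    rw [intervalIntegrable_iff_integrableOn_Icc_of_le hab]
    refine Measure.integrableOn_of_bounded (M := max (max (g a) 0) (max (g b) 0)) (by simp)
      (hm.max measurable_const).aestronglyMeasurable ?_
    filter_upwards [ae_restrict_mem measurableSet_Icc] with x hx
    rw [Real.norm_of_nonneg (le_max_right _ _)]
    exact hg.le_max_of_eq_top h hx
  · exact (hg.continuous_of_ne_top hq h).intervalIntegrable _ _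

/-- Jensen for `x ↦ x^q` bounds the mean by the `q`-mean over the interval; Hermite-Hadamard for the
convex `q`-th power then passes to the endpoints. -/
theorem PowConvex.integral_le (hg : PowConvex g q) (hq : 1 ≤ q) (hm : Measurable g)
    {a b : ℝ} (hab : a ≤ b) :
    ∫ x in a..b, max (g x) 0 ≤ (b - a) * powMean q (max (g a) 0) (max (g b) 0) := by
  rcases hab.eq_or_lt with rfl | hlt
  · simp
  unfold powMean
  split_ifs with h
  · have := intervalIntegral.integral_mono_on hab (hg.intervalIntegrable hq hm a b)
      intervalIntegrable_const fun x hx => hg.le_max_of_eq_top h hx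
    simpa using this
  · have hq1 : 1 ≤ q.toReal := by simpa using ENNReal.toReal_mono h hq
    have hc := hg.continuous_of_ne_top hq h
    have hcq : Continuous fun x => max (g x) 0 ^ q.toReal :=
      hc.rpow_const fun _ => .inr (by positivity)
    have hba : 0 < b - a := sub_pos.2 hlt
    have hjensen := (convexOn_rpow hq1).map_set_average_le (μ := volume) (t := Ioc a b)
      (f := fun x => max (g x) 0)
      (Real.continuous_rpow_const (by positivity)).continuousOn isClosed_Ici
      (by simpa using hlt) (by simp) (.of_forall fun x => mem_Ici.2 (le_max_right _ _))
      (hc.integrableOn_Ioc) hcq.integrableOn_Ioc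
    rw [← uIoc_of_le hab, interval_average_eq, interval_average_eq, smul_eq_mul,
      smul_eq_mul] at hjensen
    have hH := (hg.1 h).integral_le_average_endpoints hab
    have h0 : 0 ≤ ∫ x in a..b, max (g x) 0 :=
      intervalIntegral.integral_nonneg hab fun _ _ => le_max_right _ _
    rw [← inv_mul_le_iff₀ hba]
    have hA : 0 ≤ (b - a)⁻¹ * ∫ x in a..b, max (g x) 0 := by positivity
    calc (b - a)⁻¹ * ∫ x in a..b, max (g x) 0
        = (((b - a)⁻¹ * ∫ x in a..b, max (g x) 0) ^ q.toReal) ^ (1 / q.toReal) := by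
          rw [← Real.rpow_mul hA, mul_one_div_cancel (by positivity), Real.rpow_one]
      _ ≤ _ := by
          refine Real.rpow_le_rpow (by positivity) (hjensen.trans ?_) (by positivity)
          rwa [inv_mul_le_iff₀ hba]

/-- The antiderivative of the positive part of `F'`. -/
theorem exists_majorant {F : ℝ → ℝ} (hF : Differentiable ℝ F)
    (hsign : ∀ x, SignType.sign (F x) = SignType.sign x) (hq : 1 ≤ q)
    (hc : PowConvex (deriv F) q) :
    ∃ H : ℝ → ℝ, (∀ x, |F x| ≤ |H x|) ∧ (∀ x, 0 < H x → 0 < x) ∧ (∀ x, H x < 0 → x < 0) ∧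
      ∀ a b, |H b - H a| ≤ |b - a| * powMean q (max (deriv F a) 0) (max (deriv F b) 0) := by
  have hint := hc.intervalIntegrable hq (measurable_deriv F)
  -- Integrability of `F'` itself is not needed here, only that of its majorant `max(F', 0)`.
  have hle : ∀ {a b}, a ≤ b → F b - F a ≤ ∫ x in a..b, max (deriv F x) 0 := fun {a b} hab =>
    intervalIntegral.sub_le_integral_of_hasDeriv_right_of_le hab hF.continuous.continuousOn
      (fun x _ => (hF x).hasDerivAt.hasDerivWithinAt)
      ((intervalIntegrable_iff_integrableOn_Icc_of_le hab).1 (hint a b))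
      fun x _ => le_max_left _ _
  have hF0 : F 0 = 0 := by simpa using hsign 0
  have hFneg : ∀ x < 0, F x < 0 := fun x hx => by
    rw [← sign_eq_neg_one_iff, hsign, sign_eq_neg_one_iff.2 hx]
  have hFpos : ∀ x, 0 < x → 0 < F x := fun x hx => by
    rw [← sign_eq_one_iff, hsign, sign_eq_one_iff.2 hx]
  have hpos : ∀ x, 0 ≤ x → F x ≤ ∫ y in 0..x, max (deriv F y) 0 := fun x hx => by
    simpa [hF0] using hle hx
  have hneg : ∀ x ≤ 0, (∫ y in 0..x, max (deriv F y) 0) ≤ F x := fun x hx => by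
    have := hle hx
    rw [intervalIntegral.integral_symm]
    linarith
  refine ⟨fun x => ∫ y in 0..x, max (deriv F y) 0, fun x => ?_, fun x hx => ?_, fun x hx => ?_,
    fun a b => ?_⟩
  · rcases lt_trichotomy x 0 with h | rfl | h
    · rw [abs_of_neg (hFneg x h), abs_of_neg ((hneg x h.le).trans_lt (hFneg x h))]
      exact neg_le_neg (hneg x h.le)
    · simp [hF0]
    · rw [abs_of_pos (hFpos x h), abs_of_pos ((hFpos x h).trans_le (hpos x h.le))]
      exact hpos x h.le
  · by_contra! h
    rcases h.eq_or_lt with rfl | h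
    · simp at hx
    · linarith [hneg x h.le, hFneg x h]
  · by_contra! h
    rcases h.eq_or_lt with rfl | h
    · simp at hx
    · linarith [hpos x h.le, hFpos x h]
  · rw [intervalIntegral.integral_interval_sub_left (hint _ _) (hint _ _)]
    wlog hab : a ≤ b generalizing a b
    · rw [intervalIntegral.integral_symm, abs_neg, abs_sub_comm, powMean_comm]
      exact this b a (le_of_not_ge hab)
    rw [abs_of_nonneg (intervalIntegral.integral_nonneg hab fun _ _ => le_max_right _ _),
      abs_of_nonneg (sub_nonneg.2 hab)]
    exact hc.integral_le hq (measurable_deriv F) hab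

end RealFunctions

namespace CalcGraph

/-! ### Bounding the variation by the gradient and the half-degree. -/

section Gradient

variable {V E : Type*} {G : CalcGraph V E}

/-- An edge outside the finite family covering the support has `φ = 0` on its interior, hence at its
ends by continuity. Thus vertices with `φ ≠ 0` have finite degree, as `exists_admissible` demands.
-/
theorem IsC1Dir.finite_edges {φ : G.Point → ℝ} (hφ : G.IsC1Dir φ) :
    {e | φ (.vertex (G.src e)) ≠ 0 ∨ φ (.vertex (G.tgt e)) ≠ 0}.Finite := by
  obtain ⟨⟨hc, -⟩, ⟨A, B, -, hB, hsub⟩, -⟩ := hφ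
  refine hB.subset fun e he => ?_
  have hcont : Continuous fun t => φ (G.chart e t) := hc.comp (continuous_chart e)
  by_contra heB
  have hl := G.len_pos e
  have h0 : EqOn (fun t => φ (G.chart e t)) 0 (Ioo 0 (G.len e)) := by
    intro t ht
    by_contra hne
    have hx := hsub (subset_tsupport φ hne)
    rw [chart_of_mem ht.1 ht.2] at hx
    rcases hx with hx | hx
    · simp at hx
    · simp only [mem_iUnion] at hx
      obtain ⟨e', he', s, hs, hse⟩ := hx
      unfold chart at hse
      split_ifs at hse
      cases hse
      exact heB he'
  have h1 : EqOn (fun t => φ (G.chart e t)) 0 (Icc 0 (G.len e)) := by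
    rw [← closure_Ioo hl.ne]
    exact h0.closure hcont continuous_const
  have h2 := h1 (left_mem_Icc.2 hl.le)
  have h3 := h1 (right_mem_Icc.2 hl.le)
  simp only [chart_of_nonpos le_rfl, chart_of_ge le_rfl, Pi.zero_apply] at h2 h3
  exact he.elim (· h2) (· h3)

theorem IsC1Dir.finite_support {φ : G.Point → ℝ} (hφ : G.IsC1Dir φ) :
    (Function.support fun v => φ (.vertex v)).Finite := by
  obtain ⟨-, ⟨A, B, hA, hB, hsub⟩, -⟩ := hφ
  refine ((hA.union (hB.image G.src)).union (hB.image G.tgt)).subset fun v hv => ?_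
  rcases hsub (subset_tsupport φ hv) with h | h
  · left; left
    simpa using h
  · simp only [mem_iUnion] at h
    obtain ⟨e, he, s, hs, hse⟩ := h
    unfold chart at hse
    split_ifs at hse
    · cases hse; exact .inr ⟨e, he, rfl⟩
    · cases hse; exact .inl (.inr ⟨e, he, rfl⟩)

theorem grad_chart (φ : G.Point → ℝ) {e : E} {t : ℝ} (ht : t ∈ Ioo 0 (G.len e)) :
    G.grad φ (G.chart e t) = deriv (fun s => φ (G.chart e s)) t := by
  rw [chart_of_mem ht.1 ht.2]
  rfl

theorem IsC1.measurable_grad {φ : G.Point → ℝ} (hφ : G.IsC1 φ) : Measurable (G.grad φ) :=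
  measurable_of_continuousOn_edges (fun _ => rfl) fun e =>
    (hφ.2 e).2.continuousOn.congr fun _ ht => grad_chart φ ht

/-- The function with the value `M e` on the interior of the edge `e`. -/
def edgeFunction (M : E → ℝ) : G.Point → ℝ
  | .vertex _ => 0
  | .inner e _ _ _ => M e

theorem edgeFunction_chart (M : E → ℝ) {e : E} {t : ℝ} (ht : t ∈ Ioo 0 (G.len e)) :
    edgeFunction M (G.chart e t) = M e := by
  rw [chart_of_mem ht.1 ht.2]
  rfl

theorem measurable_edgeFunction (M : E → ℝ) : Measurable (edgeFunction (G := G) M) :=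
  measurable_of_continuousOn_edges (fun _ => rfl) fun _ =>
    continuousOn_const.congr fun _ ht => edgeFunction_chart M ht

/-- Hölder's inequality for the differences of a function along the edges. -/
theorem IsC1.tsum_mul_le {φ : G.Point → ℝ} (hφ : G.IsC1 φ) (M : E → ℝ) {p p' : ℝ≥0∞}
    (hp : p.HolderConjugate p') :
    ∑' e, ENNReal.ofReal (G.wt e) *
        (‖φ (.vertex (G.tgt e)) - φ (.vertex (G.src e))‖ₑ * ‖M e‖ₑ) ≤
      eLpNorm (G.grad φ) p G.edgeMeasure *
        eLpNorm (edgeFunction (G := G) M) p' G.edgeMeasure := by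
  have hg := hφ.measurable_grad
  have hM := measurable_edgeFunction (G := G) M
  calc _ ≤ ∫⁻ x, ‖(G.grad φ • edgeFunction M) x‖ₑ ∂G.edgeMeasure := by
        rw [lintegral_edgeMeasure G (hg.smul hM).enorm]
        refine ENNReal.tsum_le_tsum fun e => mul_le_mul_right ?_ _
        have hl := G.len_pos e
        have h := enorm_sub_le_lintegral_enorm_deriv hl.le
          (hφ.1.comp (continuous_chart e)).continuousOn (hφ.2 e).1
        simp only [Function.comp_apply, chart_of_nonpos le_rfl, chart_of_ge le_rfl] at h
        refine (mul_le_mul_left h _).trans_eq ?_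
        rw [← lintegral_mul_const _ (measurable_deriv _).enorm]
        refine setLIntegral_congr_fun measurableSet_Ioo fun t ht => ?_
        simp only [Pi.smul_apply', grad_chart φ ht, edgeFunction_chart M ht, smul_eq_mul,
          enorm_mul]
        rfl
    _ = eLpNorm (G.grad φ • edgeFunction M) 1 G.edgeMeasure := by
        rw [eLpNorm_one_eq_lintegral_enorm]
    _ ≤ _ := eLpNorm_smul_le_mul_eLpNorm hM.aestronglyMeasurable hg.aestronglyMeasurable

/-- The sum of the measures of the edges at `v`, halved, is bounded in terms of `rhoSup`. -/
theorem tsum_incident_le (v : V) :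
    ∑' e : {e : E // G.Incident v e},
        ENNReal.ofReal (G.wt e) * ENNReal.ofReal (G.len e) / 2 ≤
      G.rhoSup * ENNReal.ofReal (G.mass v) := by
  let _ : MeasurableSpace V := ⊤
  have h0 : ENNReal.ofReal (G.mass v) ≠ 0 := by simp [G.mass_pos v]
  rw [← ENNReal.div_le_iff h0 ENNReal.ofReal_ne_top, ← vertexMeasure_singleton]
  refine le_trans ?_ (le_iSup G.halfDegree v)
  unfold halfDegree
  gcongr with e
  exact wt_mul_len_le_edgeMeasure G _

/-- The summation over the edges of the mean values at the two ends, loops being left out. -/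
theorem tsum_edge_mean_le (g : V → ℝ≥0∞) :
    ∑' e, ENNReal.ofReal (G.wt e) * (ENNReal.ofReal (G.len e) *
        (open Classical in if G.src e = G.tgt e then 0 else (g (G.src e) + g (G.tgt e)) / 2)) ≤
      G.rhoSup * ∑' v, ENNReal.ofReal (G.mass v) * g v := by
  classical
  set k : E → ℝ≥0∞ := fun e => ENNReal.ofReal (G.wt e) * ENNReal.ofReal (G.len e) / 2
  calc _ ≤ ∑' e, ∑' v, if G.Incident v e then k e * g v else 0 := by
        refine ENNReal.tsum_le_tsum fun e => ?_
        -- The half-degree counts a loop once, while the two-end mean would count it twice; loops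
        -- must therefore be dropped.
        split_ifs with h
        · simp
        · refine le_trans ?_ (ENNReal.sum_le_tsum {G.src e, G.tgt e})
          rw [Finset.sum_pair h]
          simp only [Incident, true_or, or_true, if_true, k, ENNReal.div_eq_inv_mul]
          apply le_of_eq
          ring
    _ = ∑' v, (∑' e : {e : E // G.Incident v e}, k e) * g v := by
        rw [ENNReal.tsum_comm]
        congr 1 with v
        rw [← ENNReal.tsum_mul_right]
        exact ((tsum_subtype {e | G.Incident v e} fun e => k e * g v).trans
          (by simp [indicator])).symm
    _ ≤ ∑' v, G.rhoSup * (ENNReal.ofReal (G.mass v) * g v) := by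
        refine ENNReal.tsum_le_tsum fun v => ?_
        rw [← mul_assoc]
        gcongr
        exact tsum_incident_le v
    _ = _ := ENNReal.tsum_mul_left

variable [MeasurableSpace V] [DiscreteMeasurableSpace V]

theorem eLpNorm_edgeFunction_powMean_le {q : ℝ≥0∞} (hq : 1 ≤ q) {h : V → ℝ} (hh : 0 ≤ h) :
    eLpNorm (edgeFunction (G := G) fun e => open Classical in
        if G.src e = G.tgt e then 0 else powMean q (h (G.src e)) (h (G.tgt e))) q G.edgeMeasure ≤
      G.rhoSup ^ (q⁻¹).toReal * eLpNorm h q G.massMeasure := by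
  classical
  have hq0 : q ≠ 0 := (zero_lt_one.trans_le hq).ne'
  by_cases htop : q = ⊤
  -- Here the power of `rhoSup` is 1, and the essential supremum bounds `h` at every vertex.
  · subst htop
    have hb : ∀ v, ‖h v‖ₑ ≤ eLpNorm h ⊤ G.massMeasure :=
      (ae_massMeasure G).1 (by simpa using enorm_ae_le_eLpNormEssSup h G.massMeasure)
    simp only [ENNReal.inv_top, ENNReal.toReal_zero, ENNReal.rpow_zero, one_mul]
    rw [eLpNorm_exponent_top (f := edgeFunction _)]
    refine eLpNormEssSup_le_of_ae_enorm_bound (.of_forall fun x => ?_)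
    cases x with
    | vertex v => simp [edgeFunction]
    | inner e t h0 h1 =>
      simp only [edgeFunction, powMean, if_true]
      split_ifs
      · simp
      · rcases max_choice (h (G.src e)) (h (G.tgt e)) with h' | h' <;> rw [h'] <;> exact hb _
  · have hq1 : 0 < q.toReal := ENNReal.toReal_pos hq0 htop
    rw [eLpNorm_eq_lintegral_rpow_enorm_toReal hq0 htop,
      eLpNorm_eq_lintegral_rpow_enorm_toReal hq0 htop, ENNReal.toReal_inv, ← one_div,
      ← ENNReal.mul_rpow_of_nonneg _ _ (by positivity)]
    refine ENNReal.rpow_le_rpow ?_ (by positivity)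
    rw [lintegral_edgeMeasure G ((measurable_edgeFunction _).enorm.pow_const _),
      lintegral_massMeasure]
    refine le_trans (ENNReal.tsum_le_tsum fun e => mul_le_mul_right ?_ _)
      (tsum_edge_mean_le fun v => ‖h v‖ₑ ^ q.toReal)
    refine (setLIntegral_congr_fun measurableSet_Ioo fun t ht => by
      rw [edgeFunction_chart _ ht]).trans_le ?_
    rw [setLIntegral_const, Real.volume_Ioo, sub_zero, mul_comm]
    gcongr
    split_ifs
    · simp [hq1]
    · have h1 := Real.rpow_nonneg (hh (G.src e)) q.toReal
      have h2 := Real.rpow_nonneg (hh (G.tgt e)) q.toReal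
      rw [Real.enorm_of_nonneg (powMean_nonneg q (hh _) (hh _)), Real.enorm_of_nonneg (hh _),
        Real.enorm_of_nonneg (hh _), ENNReal.ofReal_rpow_of_nonneg (hh _) hq1.le,
        ENNReal.ofReal_rpow_of_nonneg (hh _) hq1.le, ENNReal.ofReal_rpow_of_nonneg
        (powMean_nonneg q (hh _) (hh _)) hq1.le, ← ENNReal.ofReal_add h1 h2, powMean, if_neg htop,
        ← Real.rpow_mul (by positivity), one_div_mul_cancel hq1.ne', Real.rpow_one,
        ENNReal.ofReal_div_of_pos two_pos]
      simp

/-- The bound for the total variation of a function with controlled differences. -/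
theorem IsC1.totalVariation_le {φ : G.Point → ℝ} (hφ : G.IsC1 φ) {p p' : ℝ≥0∞}
    (hp : p.HolderConjugate p') {h : V → ℝ} (hh : 0 ≤ h) {f : V → ℝ}
    (hf : ∀ v w, |f w - f v| ≤
      |φ (.vertex w) - φ (.vertex v)| * powMean p' (h v) (h w)) :
    G.totalVariation f ≤
      eLpNorm (G.grad φ) p G.edgeMeasure *
        (G.rhoSup ^ (p'⁻¹).toReal * eLpNorm h p' G.massMeasure) := by
  classical
  refine le_trans ?_ ((hφ.tsum_mul_le (fun e => if G.src e = G.tgt e then 0 else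
    powMean p' (h (G.src e)) (h (G.tgt e))) hp).trans
      (mul_le_mul_right (eLpNorm_edgeFunction_powMean_le hp.symm.one_le hh) _))
  refine ENNReal.tsum_le_tsum fun e => mul_le_mul_right ?_ _
  -- Dropping loops is harmless: the difference along a loop is zero.
  split_ifs with hl
  · simp [hl]
  · rw [Real.enorm_eq_ofReal_abs, Real.enorm_eq_ofReal_abs,
      Real.enorm_of_nonneg (powMean_nonneg _ (hh _) (hh _)), ← ENNReal.ofReal_mul (abs_nonneg _)]
    exact ENNReal.ofReal_le_ofReal (hf _ _)

end Gradient

/-! ### The functional inequality for `F ∘ φ`. -/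

section Sobolev

variable {V E : Type*} {G : CalcGraph V E} [MeasurableSpace V] [DiscreteMeasurableSpace V]

/-- An isoperimetric inequality for the sets on which `φ` has a fixed sign implies a functional
inequality for `F ∘ φ`. -/
theorem IsC1Dir.mul_eLpNorm_le {I p p' q : ℝ≥0∞} (hp : p.HolderConjugate p') (hq : 1 ≤ q)
    {F : ℝ → ℝ} (hF : Differentiable ℝ F) (hsign : ∀ x, SignType.sign (F x) = SignType.sign x)
    (hc : PowConvex (deriv F) p') {φ : G.Point → ℝ} (hφ : G.IsC1Dir φ)
    (hI : ∀ S, S ⊆ {v | 0 < φ (.vertex v)} ∨ S ⊆ {v | φ (.vertex v) < 0} → S.Nonempty →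
      I * G.massMeasure S ^ (1 / q.toReal) ≤ G.totalVariation (S.indicator 1)) :
    I * eLpNorm (fun x => F (φ x)) q G.vertexMeasure ≤
      G.rhoSup ^ (p'⁻¹).toReal * eLpNorm (G.grad φ) p G.edgeMeasure *
        eLpNorm (fun x => deriv F (φ x)) p' G.vertexMeasure := by
  obtain ⟨H, habs, hpos, hneg, hdiff⟩ := exists_majorant hF hsign hp.symm.one_le hc
  have hfin : (Function.support fun v : V => H (φ (.vertex v))).Finite := by
    refine hφ.finite_support.subset fun v hv => ?_
    rcases lt_or_gt_of_ne hv with h | h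
    · exact (hneg _ h).ne
    · exact (hpos _ h).ne'
  rw [eLpNorm_vertexMeasure, eLpNorm_vertexMeasure]
  calc _ ≤ I * eLpNorm (fun v => H (φ (.vertex v))) q G.massMeasure := by
        gcongr
        exact eLpNorm_mono fun v => habs _
    _ ≤ G.totalVariation fun v => H (φ (.vertex v)) :=
        mul_eLpNorm_le_totalVariation hq hfin fun S hS => hI S <|
          hS.imp (fun h v hv => hpos _ (h hv)) fun h v hv => hneg _ (h hv)
    _ ≤ _ := hφ.1.totalVariation_le hp
        (h := fun v => max (deriv F (φ (.vertex v))) 0) (fun v => le_max_right _ _)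
        fun v w => hdiff _ _
    _ ≤ _ := by
        rw [← mul_assoc, mul_comm (eLpNorm _ _ G.edgeMeasure)]
        gcongr
        refine eLpNorm_mono fun v => ?_
        rw [Real.norm_of_nonneg (le_max_right _ _)]
        exact max_le (le_abs_self _) (norm_nonneg _)

theorem IsC1Dir.isoConst_mul_le {φ : G.Point → ℝ} (hφ : G.IsC1Dir φ) {ν ν' : ℝ≥0∞}
    (hν : ν.HolderConjugate ν') (S : Set V)
    (hS : S ⊆ {v | 0 < φ (.vertex v)} ∨ S ⊆ {v | φ (.vertex v) < 0}) (hne : S.Nonempty) :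
    G.isoConst ν * G.massMeasure S ^ (1 / ν'.toReal) ≤ G.totalVariation (S.indicator 1) := by
  have hS' : ∀ v ∈ S, φ (.vertex v) ≠ 0 := fun v hv => hS.elim (fun h => (h hv).ne')
    fun h => (h hv).ne
  exact CalcGraph.isoConst_mul_le hν (hφ.finite_support.subset hS') hne
    (hφ.finite_edges.subset fun e he => he.imp (hS' _) (hS' _))
    fun v hv hvS => hS' v hvS (hφ.2.2 v hv)

theorem IsC1Dir.closedIsoConst_mul_le {φ : G.Point → ℝ} (hφ : G.IsC1Dir φ)
    (hG : G.IsClosedGraph) (hs : G.IsSplit φ) {ν ν' : ℝ≥0∞}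
    (hν : ν.HolderConjugate ν') (S : Set V)
    (hS : S ⊆ {v | 0 < φ (.vertex v)} ∨ S ⊆ {v | φ (.vertex v) < 0}) (hne : S.Nonempty) :
    G.closedIsoConst ν * G.massMeasure S ^ (1 / ν'.toReal) ≤
      G.totalVariation (S.indicator 1) := by
  have hS' : ∀ v ∈ S, φ (.vertex v) ≠ 0 := fun v hv => hS.elim (fun h => (h hv).ne')
    fun h => (h hv).ne
  have := hG.1
  have htop : ∀ T, G.massMeasure T ≠ ⊤ := fun T => (massMeasure_lt_top G T.toFinite).ne
  refine CalcGraph.closedIsoConst_mul_le hν S.toFinite hne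
    (hφ.finite_edges.subset fun e he => he.imp (hS' _) (hS' _))
    (fun v hv hvS => hS' v hvS (hφ.2.2 v hv)) ?_
  -- The split condition makes `S` weigh at most half the total, so `S` realizes the minimum in the
  -- closed isoperimetric ratio.
  have hhalf : G.massMeasure S ≤ G.massMeasure univ / 2 := by
    have h1 := hs.1
    have h2 := hs.2
    rw [vertexMeasure_apply, vertexMeasure_apply] at h1 h2
    exact hS.elim (fun h => (measure_mono h).trans h1) fun h => (measure_mono h).trans h2
  rw [measure_compl .of_discrete (htop S)]
  refine ENNReal.le_sub_of_add_le_left (htop S) ?_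
  calc G.massMeasure S + G.massMeasure S ≤ G.massMeasure univ / 2 + G.massMeasure univ / 2 := by
        gcongr
    _ = _ := ENNReal.add_halves _

end Sobolev

end CalcGraph

/-! ### The signed power `x|x|^r`. -/

section SignedPower

theorem hasDerivAt_mul_abs_rpow {r : ℝ} (hr : 0 ≤ r) (x : ℝ) :
    HasDerivAt (fun y : ℝ => y * |y| ^ r) ((r + 1) * |x| ^ r) x := by
  rcases eq_or_ne x 0 with rfl | hx
  · have hlim : (r + 1) * |(0 : ℝ)| ^ r = |(0 : ℝ)| ^ r := by
      rcases hr.eq_or_lt with rfl | hr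
      · simp
      · simp [Real.zero_rpow hr.ne']
    rw [hlim, hasDerivAt_iff_tendsto_slope_zero]
    have hc : Continuous fun t : ℝ => |t| ^ r := continuous_abs.rpow_const fun _ => .inr hr
    refine (hc.continuousAt.tendsto.mono_left nhdsWithin_le_nhds).congr' ?_
    filter_upwards [self_mem_nhdsWithin] with t ht
    simp [inv_mul_cancel_left₀ (show t ≠ 0 from ht)]
  · have h := (hasDerivAt_id x).mul
      ((hasDerivAt_abs hx).rpow_const (p := r) (.inl (abs_ne_zero.2 hx)))
    refine h.congr_deriv ?_
    have h1 : x * (SignType.sign x : ℝ) = |x| := self_mul_sign x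
    have h2 : |x| * |x| ^ (r - 1) = |x| ^ r := by
      rw [mul_comm, ← Real.rpow_add_one (abs_ne_zero.2 hx), sub_add_cancel]
    simp only [id, one_mul]
    linear_combination (r * |x| ^ (r - 1)) * h1 + r * h2

theorem sign_mul_abs_rpow (r x : ℝ) :
    SignType.sign (x * |x| ^ r) = SignType.sign x := by
  rcases eq_or_ne x 0 with rfl | hx
  · simp
  · rw [sign_mul, sign_pos (Real.rpow_pos_of_pos (abs_pos.2 hx) r), mul_one]

theorem convexOn_abs_rpow {t : ℝ} (ht : 1 ≤ t) : ConvexOn ℝ univ fun x : ℝ => |x| ^ t := by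
  have hsub : (fun x : ℝ => |x|) '' univ = Ici 0 := by
    ext y
    simp only [mem_image, mem_univ, true_and, mem_Ici]
    exact ⟨fun ⟨x, hx⟩ => hx ▸ abs_nonneg x, fun hy => ⟨y, abs_of_nonneg hy⟩⟩
  refine ConvexOn.comp (g := fun y : ℝ => y ^ t) (f := fun x : ℝ => |x|) ?_ ?_ ?_
  · rw [hsub]
    exact convexOn_rpow ht
  · exact convexOn_univ_norm
  · rw [hsub]
    exact Real.monotoneOn_rpow_Ici_of_exponent_nonneg (by positivity)

theorem powConvex_mul_abs_rpow {s r : ℝ} (hs : 0 ≤ s) {q : ℝ≥0∞}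
    (hq : q ≠ ⊤ → 1 ≤ r * q.toReal) (hq' : q = ⊤ → r = 0) :
    PowConvex (fun x => s * |x| ^ r) q := by
  constructor
  · intro h
    have hfun : (fun x : ℝ => max (s * |x| ^ r) 0 ^ q.toReal) =
        fun x => s ^ q.toReal • |x| ^ (r * q.toReal) := by
      ext x
      rw [max_eq_left (by positivity), Real.mul_rpow hs (by positivity),
        Real.rpow_mul (abs_nonneg _), smul_eq_mul]
    rw [hfun]
    exact (convexOn_abs_rpow (hq h)).smul (Real.rpow_nonneg hs q.toReal)
  · intro h
    simp only [hq' h, Real.rpow_zero]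
    exact (convexOn_const _ convex_univ).quasiconvexOn

end SignedPower

namespace CalcGraph

/-! ### The Sobolev inequality. -/

section Sobolev

variable {V E : Type*} {G : CalcGraph V E} [MeasurableSpace V] [DiscreteMeasurableSpace V]

theorem IsC1Dir.eLpNorm_ne_top {φ : G.Point → ℝ} (hφ : G.IsC1Dir φ) {t : ℝ} (ht : 0 < t) :
    eLpNorm φ (ENNReal.ofReal t) G.vertexMeasure ≠ ⊤ := by
  rw [eLpNorm_vertexMeasure, ← lt_top_iff_ne_top,
    eLpNorm_lt_top_iff_lintegral_rpow_enorm_lt_top (by simpa using ht) ENNReal.ofReal_ne_top,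
    lintegral_massMeasure, ENNReal.toReal_ofReal ht.le,
    tsum_eq_sum (s := hφ.finite_support.toFinset) fun v hv => by
      simp only [Finite.mem_toFinset, Function.mem_support, not_not] at hv
      simp [hv, ht]]
  exact ENNReal.sum_lt_top.2 fun v _ => ENNReal.mul_lt_top ENNReal.ofReal_lt_top
    (ENNReal.rpow_lt_top_of_nonneg ht.le enorm_ne_top)

/-- The Sobolev inequality, from an isoperimetric inequality for the sets on which `φ` has a fixed
sign. -/
theorem IsC1Dir.sobolev {I : ℝ≥0∞} {ν p : ℝ} (hp : 1 ≤ p) (hpν : p < ν) {φ : G.Point → ℝ}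
    (hφ : G.IsC1Dir φ)
    (hI : ∀ S, S ⊆ {v | 0 < φ (.vertex v)} ∨ S ⊆ {v | φ (.vertex v) < 0} → S.Nonempty →
      I * G.massMeasure S ^ (1 / (ENNReal.ofReal (ν / (ν - 1))).toReal) ≤
        G.totalVariation (S.indicator 1)) :
    G.sobolevConst I ν p * eLpNorm φ (ENNReal.ofReal (p * ν / (ν - p))) G.vertexMeasure ≤
      eLpNorm (G.grad φ) (ENNReal.ofReal p) G.edgeMeasure := by
  have hp0 : 0 < p := by linarith
  have hν1 : 0 < ν - 1 := by linarith
  have hνp : 0 < ν - p := by linarith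
  have hν0 : 0 < ν := by linarith
  set t := p * ν / (ν - p) with ht
  have ht0 : 0 < t := by positivity
  -- This exponent satisfies `(r + 1) ν' = t` and, for `p > 1`, `r p' = t`; moreover `r + 1` is the
  -- inverse of the constant `(ν - p) / (p (ν - 1))`.
  set r := ν * (p - 1) / (ν - p) with hr
  have hr0 : 0 ≤ r := div_nonneg (mul_nonneg hν0.le (by linarith)) hνp.le
  have hs : (ν - p) / (p * (ν - 1)) = (r + 1)⁻¹ := by
    rw [hr, div_add_one hνp.ne', inv_div]
    congr 1; ring
  set N := eLpNorm φ (ENNReal.ofReal t) G.vertexMeasure with hN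
  have hNtop : N ≠ ⊤ := hφ.eLpNorm_ne_top ht0
  have hq1 : 1 ≤ ENNReal.ofReal (ν / (ν - 1)) := by
    rw [ENNReal.one_le_ofReal, one_le_div hν1]
    linarith
  have hderiv : deriv (fun y : ℝ => y * |y| ^ r) = fun x => (r + 1) * |x| ^ r :=
    funext fun x => (hasDerivAt_mul_abs_rpow hr0 x).deriv
  have hFnorm : eLpNorm (fun x => φ x * |φ x| ^ r) (ENNReal.ofReal (ν / (ν - 1)))
      G.vertexMeasure = N ^ (r + 1) := by
    have h1 : ENNReal.ofReal (ν / (ν - 1)) * ENNReal.ofReal (r + 1) = ENNReal.ofReal t := by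
      rw [← ENNReal.ofReal_mul (by positivity)]
      congr 1
      rw [hr, ht]
      field_simp
      ring
    rw [hN, ← h1, ← eLpNorm_norm_rpow _ (by positivity)]
    refine eLpNorm_congr_norm_ae (.of_forall fun x => ?_)
    rw [norm_mul, Real.norm_of_nonneg (Real.rpow_nonneg (abs_nonneg (φ x)) r),
      Real.norm_of_nonneg (Real.rpow_nonneg (norm_nonneg (φ x)) (r + 1)),
      Real.rpow_add_one' (norm_nonneg _) (by positivity), mul_comm, Real.norm_eq_abs]
  obtain ⟨p', hpp', htop, hntop, hpinv, hDnorm⟩ : ∃ p' : ℝ≥0∞,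
      (ENNReal.ofReal p).HolderConjugate p' ∧ (p' = ⊤ → r = 0) ∧
      (p' ≠ ⊤ → 1 ≤ r * p'.toReal) ∧ (p'⁻¹).toReal = (p - 1) / p ∧
      eLpNorm (fun x => |φ x| ^ r) p' G.vertexMeasure ≤ N ^ r := by
    -- For `p = 1` one has `p' = ∞` and `r = 0`, so `F` is the identity and `F'` is constant.
    rcases hp.eq_or_lt with rfl | hp1
    · have hr' : r = 0 := by simp [hr]
      refine ⟨⊤, by rw [ENNReal.ofReal_one]; infer_instance, fun _ => hr', fun h => absurd rfl h,
        by simp, ?_⟩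
      simp only [hr', Real.rpow_zero, ENNReal.rpow_zero]
      rw [eLpNorm_exponent_top]
      exact eLpNormEssSup_le_of_ae_enorm_bound (.of_forall fun x => by simp)
    · have hp1' : 0 < p - 1 := by linarith
      have hpos : 0 < p / (p - 1) := by positivity
      have hrp : r * (p / (p - 1)) = t := by
        rw [hr, ht]
        field_simp
      have hr1 : 0 < r := div_pos (mul_pos hν0 hp1') hνp
      refine ⟨_, (Real.HolderConjugate.conjExponent hp1).ennrealOfReal,
        fun h => absurd h ENNReal.ofReal_ne_top, fun _ => ?_, ?_, ?_⟩
      · rw [Real.conjExponent, ENNReal.toReal_ofReal hpos.le, hrp, ht, one_le_div hνp]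
        nlinarith
      · rw [Real.conjExponent, ENNReal.toReal_inv, ENNReal.toReal_ofReal hpos.le, inv_div]
      · refine (eLpNorm_norm_rpow φ hr1).trans_le ?_
        rw [Real.conjExponent, ← ENNReal.ofReal_mul hpos.le, mul_comm, hrp]
  have key := hφ.mul_eLpNorm_le hpp' hq1 (F := fun y => y * |y| ^ r)
    (fun x => (hasDerivAt_mul_abs_rpow hr0 x).differentiableAt) (sign_mul_abs_rpow r)
    (by rw [hderiv]; exact powConvex_mul_abs_rpow (by positivity) hntop htop) hI
  rw [hFnorm, hderiv, hpinv] at key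
  have hD : eLpNorm (fun x => (r + 1) * |φ x| ^ r) p' G.vertexMeasure ≤
      ENNReal.ofReal (r + 1) * N ^ r := by
    refine (eLpNorm_const_smul (r + 1) (fun x => |φ x| ^ r) p' G.vertexMeasure).trans_le ?_
    rw [Real.enorm_of_nonneg (by positivity)]
    gcongr
  -- Cancelling `N ^ r` requires `N` to be nonzero and finite; finiteness comes from the finite
  -- support of `φ` on the vertices.
  rcases eq_or_ne N 0 with hN0 | hN0
  · simp [hN0]
  set D := eLpNorm (G.grad φ) (ENNReal.ofReal p) G.edgeMeasure
  set y := G.rhoSup ^ ((p - 1) / p) with hy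
  have hc0 : ENNReal.ofReal (r + 1) ≠ 0 := by
    rw [Ne, ENNReal.ofReal_eq_zero, not_le]
    positivity
  have h1 : I * N * N ^ r ≤ D * ENNReal.ofReal (r + 1) * y * N ^ r := by
    calc I * N * N ^ r = I * N ^ (r + 1) := by
          rw [ENNReal.rpow_add r 1 hN0 hNtop, ENNReal.rpow_one]
          ring
      _ ≤ y * D * (ENNReal.ofReal (r + 1) * N ^ r) := key.trans (mul_le_mul_right hD _)
      _ = _ := by ring
  rw [ENNReal.mul_le_mul_iff_left (by simp [hN0, hNtop])
    (ENNReal.rpow_ne_top_of_nonneg hr0 hNtop)] at h1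
  -- These divisions are valid in `[0, ∞]` even if `y` is 0 or `∞`.
  have h2 := ENNReal.div_le_of_le_mul (ENNReal.div_le_of_le_mul h1)
  refine le_trans (le_of_eq ?_) h2
  rw [sobolevConst, hs, ENNReal.rpow_neg, ENNReal.ofReal_inv_of_pos (by positivity),
    ENNReal.div_eq_inv_mul, ENNReal.div_eq_inv_mul]
  ring

end Sobolev

end CalcGraph

end

theorem mainTheorem5 {V E : Type*} (G : CalcGraph V E) :
    -- the general bound, for arbitrary graphs and for closed graphs
    (∀ (ν ν' p p' : ℝ≥0∞), ν.HolderConjugate ν' → p.HolderConjugate p' →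
      ∀ F : ℝ → ℝ, Differentiable ℝ F → (∀ x, SignType.sign (F x) = SignType.sign x) →
        PowConvex (deriv F) p' → ∀ φ : G.Point → ℝ, G.IsC1Dir φ →
          (G.isoConst ν * eLpNorm (fun x => F (φ x)) ν' G.vertexMeasure ≤
            G.rhoSup ^ (p'⁻¹).toReal * eLpNorm (G.grad φ) p G.edgeMeasure *
              eLpNorm (fun x => deriv F (φ x)) p' G.vertexMeasure) ∧
          (G.IsClosedGraph → G.IsSplit φ →
            G.closedIsoConst ν * eLpNorm (fun x => F (φ x)) ν' G.vertexMeasure ≤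
              G.rhoSup ^ (p'⁻¹).toReal * eLpNorm (G.grad φ) p G.edgeMeasure *
                eLpNorm (fun x => deriv F (φ x)) p' G.vertexMeasure)) ∧
    -- the Sobolev inequality, for arbitrary graphs and for closed graphs
    (∀ (ν p : ℝ), 1 ≤ p → p < ν → ∀ φ : G.Point → ℝ, G.IsC1Dir φ →
      (G.sobolevConst (G.isoConst (ENNReal.ofReal ν)) ν p *
          eLpNorm φ (ENNReal.ofReal (p * ν / (ν - p))) G.vertexMeasure ≤
        eLpNorm (G.grad φ) (ENNReal.ofReal p) G.edgeMeasure) ∧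
      (G.IsClosedGraph → G.IsSplit φ →
        G.sobolevConst (G.closedIsoConst (ENNReal.ofReal ν)) ν p *
            eLpNorm φ (ENNReal.ofReal (p * ν / (ν - p))) G.vertexMeasure ≤
          eLpNorm (G.grad φ) (ENNReal.ofReal p) G.edgeMeasure)) := by
  -- The statement involves no measurable structure on `V`; the discrete one serves the proof.
  let _ : MeasurableSpace V := ⊤
  have : DiscreteMeasurableSpace V := ⟨fun _ => trivial⟩
  refine ⟨fun ν ν' p p' hν hp F hF hsign hc φ hφ => ⟨?_, fun hG hs => ?_⟩,
    fun ν p hp hpν φ hφ => ?_⟩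
  · exact hφ.mul_eLpNorm_le hp hν.symm.one_le hF hsign hc (hφ.isoConst_mul_le hν)
  · exact hφ.mul_eLpNorm_le hp hν.symm.one_le hF hsign hc (hφ.closedIsoConst_mul_le hG hs hν)
  · have hν := (Real.HolderConjugate.conjExponent (hp.trans_lt hpν)).ennrealOfReal
    exact ⟨hφ.sobolev hp hpν (hφ.isoConst_mul_le hν),
      fun hG hs => hφ.sobolev hp hpν (hφ.closedIsoConst_mul_le hG hs hν)⟩
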